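/- Let $(\Omega,\mathcal F,P)$ be a probability space carrying a two-sided Brownian motion $B=(B_t)_{t\in\mathbb R}$, that is, a centered Gaussian process with continuous paths and $\operatorname{Cov}(B_s,B_t)=\tfrac12(|s|+|t|-|s-t|)$, and a strictly positive random variable $A$ that is independent of $B$. Let $R_A\in[0,\infty]$ be the maximal radius such that the Laplace transform $t\mapsto E[e^{-tA}]$, $t\ge 0$, extends holomorphically to the open ball $\{z\in\mathbb C: |z|<R_A\}$, and assume that $R_A>0$. For $f\in L^2(\mathbb R)$ let $I(f)=\int_{\mathbb R} f(t)\,dB_t$ be the Wiener integral, let $L^2_A:=L^2(\Omega,\sigma(B,A),P)$, and let $D_A$ be the set of real-valued Schwartz functions $\eta\in\mathcal S(\mathbb R)$ with $2\|\eta\|_{2}^2<R_A$. For $\eta\in D_A$ put $$W_A(\eta):=e^{\sqrt A\, I(\eta)}\,\Big(E\big[e^{\sqrt A\, I(\eta)}\big]\Big)^{-1},$$ and for $\Theta\in L^2_A$ and $\eta\in D_A$ put $S_A[\Theta](\eta):=E[\Theta\, W_A(\eta)]$. Then for all $\Theta,\Phi\in L^2_A$ we have $S_A[\Theta](\eta)=S_A[\Phi](\eta)$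 for all $\eta\in D_A$ if and only if $\Theta=\Phi$ (as elements of $L^2_A$). -/

import Mathlib

open MeasureTheory ProbabilityTheory Set
open scoped ENNReal SchwartzMap

namespace ScaledWiener

noncomputable section

/-- A two-sided Brownian motion `(B_t)_{t ∈ ℝ}` on the probability space `(Ω, P)`: a centered
Gaussian process with (almost surely) continuous paths and covariance `(|s| + |t| - |s - t|) / 2`.
In particular `B_0 = 0` almost surely. -/
structure IsTwoSidedBrownianMotion {Ω : Type*} [MeasurableSpace Ω]
    (B : ℝ → Ω → ℝ) (P : Measure Ω) : Prop where
  measurable : ∀ t, Measurable (B t)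
  gaussian : IsGaussianProcess B P
  mean : ∀ t, ∫ ω, B t ω ∂P = 0
  covariance : ∀ s t, cov[B s, B t; P] = (|s| + |t| - |s - t|) / 2
  continuous : ∀ᵐ ω ∂P, Continuous fun t => B t ω

/-- Pairs `s ≤ t`, indexing the half-open bounded intervals `(s, t]`. -/
abbrev Interval : Type := {p : ℝ × ℝ // p.1 ≤ p.2}

/-- Formal step functions `∑ cᵢ 𝟙_{(sᵢ, tᵢ]}`, mapped to the step functions in `L²(ℝ)`. -/
def stepFun : (Interval →₀ ℝ) →ₗ[ℝ] Lp ℝ 2 (volume : Measure ℝ) :=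
  Finsupp.linearCombination ℝ fun p =>
    indicatorConstLp 2 (measurableSet_Ioc : MeasurableSet (Ioc p.1.1 p.1.2))
      measure_Ioc_lt_top.ne (1 : ℝ)

open Classical in
/-- The increment `B_t - B_s` as an element of `L²(P)` (the value `0` in the second case
is never taken by a Brownian motion). -/
def incrementLp {Ω : Type*} [MeasurableSpace Ω] (P : Measure Ω) (B : ℝ → Ω → ℝ) (s t : ℝ) :
    Lp ℝ 2 P :=
  if h : MemLp (fun ω => B t ω - B s ω) 2 P then h.toLp else 0

/-- The elementary Wiener integral `∑ cᵢ 𝟙_{(sᵢ, tᵢ]} ↦ ∑ cᵢ (B_{tᵢ} - B_{sᵢ})`. -/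
def elementaryIntegral {Ω : Type*} [MeasurableSpace Ω] (P : Measure Ω) (B : ℝ → Ω → ℝ) :
    (Interval →₀ ℝ) →ₗ[ℝ] Lp ℝ 2 P :=
  Finsupp.linearCombination ℝ fun p => incrementLp P B p.1.1 p.1.2

/-- The Wiener integral `I(f) = ∫ f dB` of `f ∈ L²(ℝ)`: the continuous linear extension to
`L²(ℝ)` of the elementary integral on step functions. -/
def wienerIntegral {Ω : Type*} [MeasurableSpace Ω] (P : Measure Ω) (B : ℝ → Ω → ℝ) :
    Lp ℝ 2 (volume : Measure ℝ) →L[ℝ] Lp ℝ 2 P :=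
  (elementaryIntegral P B).extendOfNorm stepFun

theorem denseRange_stepFun : DenseRange stepFun := by
  have hr : Set.range stepFun = ((LinearMap.range stepFun : Submodule ℝ _) : Set _) := by
    ext; simp
  have key : (LinearMap.range stepFun).topologicalClosure = ⊤ := by
    rw [Submodule.topologicalClosure_eq_top_iff, Submodule.eq_bot_iff]
    intro f hf
    rw [Submodule.mem_orthogonal] at hf
    have h0 : ∀ s t : ℝ, s ≤ t → ∫ x in Ioc s t, f x = 0 := by
      intro s t hst
      have h := hf (stepFun (Finsupp.single ⟨(s, t), hst⟩ 1)) ⟨_, rfl⟩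
      simp only [stepFun, Finsupp.linearCombination_single, one_smul] at h
      rwa [L2.inner_indicatorConstLp_one] at h
    have hloc : LocallyIntegrable f (volume : Measure ℝ) :=
      (Lp.memLp f).locallyIntegrable (by norm_num)
    have h1 : ∀ x : ℝ, ∫ y in (0 : ℝ)..x, f y = 0 := by
      intro x
      rcases le_total 0 x with hx | hx
      · rw [intervalIntegral.integral_of_le hx, h0 _ _ hx]
      · rw [intervalIntegral.integral_of_ge hx, h0 _ _ hx, neg_zero]
    apply Lp.ext
    filter_upwards [LocallyIntegrable.ae_hasDerivAt_integral hloc, Lp.coeFn_zero ℝ 2 (volume : Measure ℝ)]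
      with x hx hz
    have h2 := hx 0
    simp only [h1] at h2
    rw [hz]
    exact (h2.unique (hasDerivAt_const x (0 : ℝ)))
  rw [DenseRange, hr]
  exact (Submodule.dense_iff_topologicalClosure_eq_top).2 key

theorem volume_real_Ioc_inter {s t u v : ℝ} (hst : s ≤ t) (huv : u ≤ v) :
    volume.real (Ioc s t ∩ Ioc u v) = (|t - u| + |s - v| - |t - v| - |s - u|) / 2 := by
  rw [Ioc_inter_Ioc, Measure.real, Real.volume_Ioc, ENNReal.toReal_ofReal']
  rcases le_total s u with h1 | h1 <;> rcases le_total t v with h2 | h2 <;>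
  rcases le_total t u with h3 | h3 <;> rcases le_total s v with h4 | h4 <;>
  simp only [max_def, min_def, abs_eq_max_neg] <;> grind

section

variable {Ω : Type*} [MeasurableSpace Ω] {P : Measure Ω} {B : ℝ → Ω → ℝ}

theorem IsTwoSidedBrownianMotion.memLp (hB : IsTwoSidedBrownianMotion B P) (t : ℝ) :
    MemLp (B t) 2 P :=
  (hB.gaussian.hasGaussianLaw_eval t).memLp_two

theorem IsTwoSidedBrownianMotion.memLp_increment (hB : IsTwoSidedBrownianMotion B P) (s t : ℝ) :
    MemLp (fun ω => B t ω - B s ω) 2 P :=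
  (hB.memLp t).sub (hB.memLp s)

theorem IsTwoSidedBrownianMotion.coeFn_incrementLp (hB : IsTwoSidedBrownianMotion B P) (s t : ℝ) :
    incrementLp P B s t =ᵐ[P] fun ω => B t ω - B s ω := by
  rw [incrementLp, dif_pos (hB.memLp_increment s t)]
  exact MemLp.coeFn_toLp _

theorem IsTwoSidedBrownianMotion.inner_incrementLp (hB : IsTwoSidedBrownianMotion B P)
    {s t u v : ℝ} (hst : s ≤ t) (huv : u ≤ v) :
    inner ℝ (incrementLp P B s t) (incrementLp P B u v) = volume.real (Ioc s t ∩ Ioc u v) := by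
  have := hB.gaussian.isProbabilityMeasure
  have hm : ∀ s t : ℝ, ∫ ω, (B t ω - B s ω) ∂P = 0 := fun s t => by
    rw [integral_sub ((hB.memLp t).integrable (by norm_num))
      ((hB.memLp s).integrable (by norm_num)), hB.mean, hB.mean, sub_zero]
  have h1 : inner ℝ (incrementLp P B s t) (incrementLp P B u v)
      = cov[fun ω => B t ω - B s ω, fun ω => B v ω - B u ω; P] := by
    rw [ProbabilityTheory.covariance, L2.inner_def]
    apply integral_congr_ae
    filter_upwards [hB.coeFn_incrementLp s t, hB.coeFn_incrementLp u v] with ω h1 h2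
    rw [h1, h2, hm, hm]
    simp [mul_comm]
  rw [h1, covariance_fun_sub_fun_sub (hB.memLp _) (hB.memLp _) (hB.memLp _) (hB.memLp _)]
  simp only [hB.covariance]
  rw [volume_real_Ioc_inter hst huv]
  ring

theorem IsTwoSidedBrownianMotion.norm_elementaryIntegral (hB : IsTwoSidedBrownianMotion B P)
    (c : Interval →₀ ℝ) : ‖elementaryIntegral P B c‖ = ‖stepFun c‖ := by
  have h : inner ℝ (elementaryIntegral P B c) (elementaryIntegral P B c)
      = inner ℝ (stepFun c) (stepFun c) := by
    simp only [elementaryIntegral, stepFun, Finsupp.linearCombination_apply, Finsupp.sum,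
      sum_inner, inner_sum, real_inner_smul_left, real_inner_smul_right]
    refine Finset.sum_congr rfl fun p _ => Finset.sum_congr rfl fun q _ => ?_
    rw [hB.inner_incrementLp q.2 p.2,
      L2.real_inner_indicatorConstLp_one_indicatorConstLp_one measurableSet_Ioc measurableSet_Ioc
        measure_Ioc_lt_top.ne measure_Ioc_lt_top.ne]
  rw [real_inner_self_eq_norm_sq, real_inner_self_eq_norm_sq] at h
  exact (sq_eq_sq₀ (norm_nonneg _) (norm_nonneg _)).1 h

/-- For a Brownian motion, the Wiener integral is given by the elementary integral on step
functions. -/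
theorem IsTwoSidedBrownianMotion.wienerIntegral_stepFun (hB : IsTwoSidedBrownianMotion B P)
    (c : Interval →₀ ℝ) : wienerIntegral P B (stepFun c) = elementaryIntegral P B c :=
  LinearMap.extendOfNorm_eq denseRange_stepFun
    ⟨1, fun c => by rw [one_mul, hB.norm_elementaryIntegral]⟩ c

/-- For a Brownian motion, the Wiener integral is an isometry. -/
theorem IsTwoSidedBrownianMotion.norm_wienerIntegral (hB : IsTwoSidedBrownianMotion B P)
    (f : Lp ℝ 2 (volume : Measure ℝ)) : ‖wienerIntegral P B f‖ = ‖f‖ := by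
  refine denseRange_stepFun.induction_on (p := fun f => ‖wienerIntegral P B f‖ = ‖f‖) f
    (isClosed_eq (by fun_prop) (by fun_prop)) fun c => ?_
  rw [hB.wienerIntegral_stepFun, hB.norm_elementaryIntegral]

end

/-- The Laplace transform `t ↦ ∫_{(0,∞)} e^{-t x} μ(dx)` of a measure on the half-line. -/
def laplace (μ : Measure ℝ) (t : ℝ) : ℝ := ∫ x in Ioi (0 : ℝ), Real.exp (-t * x) ∂μ

/-- The Laplace transform of `μ` (a function on `[0, ∞)`) extends to a holomorphic function on
the open ball of radius `R ∈ [0, ∞]` around `0` in `ℂ`. -/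
def LaplaceExtendsTo (μ : Measure ℝ) (R : ℝ≥0∞) : Prop :=
  ∃ f : ℂ → ℂ, DifferentiableOn ℂ f (Metric.eball 0 R) ∧
    ∀ t : ℝ, 0 ≤ t → ENNReal.ofReal t < R → f t = laplace μ t

/-- The maximal radius `R ∈ [0, ∞]` such that the Laplace transform of `μ` is holomorphic on the
open ball of radius `R` around `0`. -/
def laplaceRadius (μ : Measure ℝ) : ℝ≥0∞ := sSup {R | LaplaceExtendsTo μ R}

section

variable {Ω : Type*} [MeasurableSpace Ω]

/-- The σ-algebra `σ(B, A)`. -/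
@[reducible] def sigmaBA (B : ℝ → Ω → ℝ) (A : Ω → ℝ) : MeasurableSpace Ω :=
  (⨆ t, MeasurableSpace.comap (B t) inferInstance) ⊔ MeasurableSpace.comap A inferInstance

/-- `L²_A = L²(Ω, σ(B, A), P)`, as the space of elements of `L²(Ω, P)` that are measurable with
respect to `σ(B, A)`. -/
abbrev L2A (P : Measure Ω) (B : ℝ → Ω → ℝ) (A : Ω → ℝ) : Submodule ℝ (Lp ℝ 2 P) :=
  lpMeas ℝ ℝ (sigmaBA B A) 2 P

/-- The set `D_A` of admissible test functions: the real Schwartz functions `η` with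
`2 ‖η‖₂² < R_A`, where `R_A` is the radius for the law of `A`. -/
def admissible (P : Measure Ω) (A : Ω → ℝ) : Set 𝓢(ℝ, ℝ) :=
  {η | ENNReal.ofReal (2 * ‖η.toLp 2 (volume : Measure ℝ)‖ ^ 2) < laplaceRadius (P.map A)}

/-- The exponential `e^{√A I(η)}`. -/
def scaledExp (P : Measure Ω) (B : ℝ → Ω → ℝ) (A : Ω → ℝ) (η : 𝓢(ℝ, ℝ)) (ω : Ω) : ℝ :=
  Real.exp (Real.sqrt (A ω) * wienerIntegral P B (η.toLp 2 volume) ω)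

/-- The Wick-`A` exponential `W_A(η) = e^{√A I(η)} E[e^{√A I(η)}]⁻¹`. -/
def wickExp (P : Measure Ω) (B : ℝ → Ω → ℝ) (A : Ω → ℝ) (η : 𝓢(ℝ, ℝ)) (ω : Ω) : ℝ :=
  scaledExp P B A η ω * (∫ ω', scaledExp P B A η ω' ∂P)⁻¹

/-- The `S_A`-transform `S_A[Θ] : D_A → ℝ`, `η ↦ E[Θ W_A(η)]`, of `Θ ∈ L²_A`. -/
def transformSA (P : Measure Ω) (B : ℝ → Ω → ℝ) (A : Ω → ℝ) (Θ : L2A P B A)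
    (η : admissible P A) : ℝ :=
  ∫ ω, (Θ : Lp ℝ 2 P) ω * wickExp P B A η ω ∂P

end

end

end ScaledWiener

namespace ScaledWiener

open Filter Topology

/-! Put `Ψ = Θ - Φ`. The normalising constant in `W_A(η)` is positive, so equal transforms say that
`E[Ψ e^{√A I(η)}] = 0`; only small `η` are needed to conclude `Ψ = 0`.

A Landau-type argument turns `R_A > 0` into a finite moment `E[e^{sA}]` with `s > 0`
(`exists_integrable_exp_of_laplaceRadius_pos`). Averaging the Gaussian moment generating function
over the independent `A` then puts `e^{√A I(η)}` in `L²(P)` when `2‖η‖² < s`. Replacing `η` by `tη`,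
the `Ψ`-weighted moment generating function of `√A I(η)` vanishes for real `t` near `0`, hence on a
vertical strip by analytic continuation, and in particular at `i` (`integral_smul_cexp_eq_zero`). So
`E[Ψ e^{i√A I(f)}] = 0` for Schwartz `f`, and for all `f` in `L²(ℝ)` by density.

For step functions `f` these are the characteristic functions of the increments of `√A B` under
`Ψ⁺P` and `Ψ⁻P`; the two image laws agree, and `Ψ` integrates to `0` over every event generated by
these increments. The strong law applied to their squares recovers `A`, and then `B`, almost surely
(`sigmaBA_le_eventuallyMeasurableSpace`). These events therefore exhaust `σ(B, A)` up to null sets,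
and `Ψ = 0`. -/

/-! ### Exponential moments from a holomorphic Laplace transform -/

theorem laplace_eq_mgf {μ : Measure ℝ} (hμ : ∀ᵐ x ∂μ, 0 < x) (t : ℝ) :
    laplace μ t = mgf (fun x => -x) μ t := by
  rw [laplace, mgf, Measure.restrict_eq_self_of_ae_mem (s := Ioi 0) hμ]
  simp

theorem Ioi_subset_interior_integrableExpSet_neg {μ : Measure ℝ} [IsFiniteMeasure μ]
    (hμ : ∀ᵐ x ∂μ, 0 < x) : Ioi 0 ⊆ interior (integrableExpSet (fun x => -x) μ) := by
  refine interior_maximal (fun t (ht : 0 < t) => ?_) isOpen_Ioi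
  refine (integrable_const (1 : ℝ)).mono (by fun_prop) ?_
  filter_upwards [hμ] with x hx
  simp only [Real.norm_eq_abs, Real.abs_exp, abs_one, Real.exp_le_one_iff]
  nlinarith

/-- A nonnegative function whose scaled moments are summable has exponential moments. -/
theorem integrable_exp_of_summable {α : Type*} [MeasurableSpace α] {μ : Measure α}
    {X w : α → ℝ} (hX : AEMeasurable X μ) (hw : AEMeasurable w μ) (hX0 : ∀ᵐ x ∂μ, 0 ≤ X x)
    (hw0 : ∀ᵐ x ∂μ, 0 ≤ w x) (hint : ∀ n : ℕ, Integrable (fun x => X x ^ n / n.factorial * w x) μ)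
    (hsum : Summable fun n : ℕ => ∫ x, X x ^ n / n.factorial * w x ∂μ) :
    Integrable (fun x => Real.exp (X x) * w x) μ := by
  refine ⟨by fun_prop, ?_⟩
  have h0 : ∀ᵐ x ∂μ, 0 ≤ Real.exp (X x) * w x := by
    filter_upwards [hw0] with x hx using by positivity
  have h1 : ∀ n : ℕ, ∀ᵐ x ∂μ, 0 ≤ X x ^ n / n.factorial * w x := fun n => by
    filter_upwards [hw0, hX0] with x hx hx' using by positivity
  rw [hasFiniteIntegral_iff_ofReal h0]
  calc ∫⁻ x, ENNReal.ofReal (Real.exp (X x) * w x) ∂μ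
      = ∫⁻ x, ∑' n : ℕ, ENNReal.ofReal (X x ^ n / n.factorial * w x) ∂μ := by
        refine lintegral_congr_ae ?_
        filter_upwards [ae_all_iff.2 h1] with x hx
        have hs : HasSum (fun n : ℕ => X x ^ n / n.factorial * w x) (Real.exp (X x) * w x) := by
          have := NormedSpace.expSeries_div_hasSum_exp (X x)
          rw [← Real.exp_eq_exp_ℝ] at this
          exact this.mul_right _
        rw [← hs.tsum_eq, ENNReal.ofReal_tsum_of_nonneg hx hs.summable]
    _ = ∑' n : ℕ, ENNReal.ofReal (∫ x, X x ^ n / n.factorial * w x ∂μ) := by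
        rw [lintegral_tsum fun n => by fun_prop]
        exact tsum_congr fun n => (ofReal_integral_eq_lintegral_ofReal (hint n) (h1 n)).symm
    _ < ∞ := by
        rw [← ENNReal.ofReal_tsum_of_nonneg (fun n => integral_nonneg_of_ae (h1 n)) hsum]
        exact ENNReal.ofReal_lt_top

/-- If the Laplace transform of a law on `(0, ∞)` has a holomorphic extension around `0`, then the
law has some exponential moment. -/
theorem exists_integrable_exp_of_laplaceRadius_pos {μ : Measure ℝ} [IsFiniteMeasure μ]
    (hμ : ∀ᵐ x ∂μ, 0 < x) (hR : 0 < laplaceRadius μ) :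
    ∃ s : ℝ, 0 < s ∧ Integrable (fun x => Real.exp (s * x)) μ := by
  obtain ⟨R, ⟨f, hf, hfL⟩, hR0⟩ := lt_sSup_iff.1 hR
  obtain ⟨r, hr0, hrR⟩ : ∃ r : ℝ, 0 < r ∧ ENNReal.ofReal r ≤ R := by
    obtain ⟨q, hq0, hqR⟩ := ENNReal.lt_iff_exists_nnreal_btwn.1 hR0
    exact ⟨q, by simpa using hq0, by simpa using hqR.le⟩
  have hf' : DifferentiableOn ℂ f (Metric.ball 0 r) := by
    refine hf.mono ?_
    rw [← Metric.eball_ofReal]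
    exact Metric.eball_subset_eball hrR
  -- The ball of radius `c` about `c` lies in the right half-plane, where the transform is analytic.
  -- The ball of radius `3c` about `c` stays inside `|z| < 4c = r` and contains `-c`, so the Taylor
  -- series at `c` converges at `-c`.
  set c : ℝ := r / 4 with hc
  have hc0 : 0 < c := by positivity
  have hI := Ioi_subset_interior_integrableExpSet_neg hμ
  have hre : ∀ z ∈ Metric.ball (c : ℂ) c, 0 < z.re := by
    intro z hz
    have h1 := (abs_lt.1 ((Complex.abs_re_le_norm _).trans_lt (mem_ball_iff_norm.1 hz))).1
    simp at h1
    linarith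
  have hsub : ∀ ρ ≤ 3 * c, Metric.ball (c : ℂ) ρ ⊆ Metric.ball 0 r := by
    intro ρ hρ
    refine Metric.ball_subset_ball' ?_
    rw [dist_zero_right, Complex.norm_real, Real.norm_of_nonneg hc0.le]
    linarith
  have hEq : EqOn f (complexMGF (fun x => -x) μ) (Metric.ball (c : ℂ) c) := by
    refine AnalyticOnNhd.eqOn_of_preconnected_of_frequently_eq (z₀ := (c : ℂ))
      ((hf'.mono (hsub c (by linarith))).analyticOnNhd Metric.isOpen_ball)
      (analyticOnNhd_complexMGF.mono fun z hz => hI (hre z hz))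
      (convex_ball _ _).isPreconnected (Metric.mem_ball_self hc0) ?_
    have hreal : ∀ᶠ t : ℝ in 𝓝[≠] c, f t = complexMGF (fun x => -x) μ t := by
      refine eventually_nhdsWithin_of_eventually_nhds ?_
      filter_upwards [Ioo_mem_nhds hc0 (show c < r by linarith)] with t ht
      rw [hfL t ht.1.le (((ENNReal.ofReal_lt_ofReal_iff hr0).2 ht.2).trans_le hrR),
        laplace_eq_mgf hμ, complexMGF_ofReal]
    have hmap : Tendsto (fun t : ℝ => (t : ℂ)) (𝓝[≠] c) (𝓝[≠] (c : ℂ)) :=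
      tendsto_nhdsWithin_iff.2 ⟨Complex.continuous_ofReal.continuousAt.mono_left nhdsWithin_le_nhds,
        by filter_upwards [self_mem_nhdsWithin] with t ht using by simpa using ht⟩
    exact hmap.frequently hreal.frequently
  have hder : ∀ n : ℕ, iteratedDeriv n f c = ((∫ x, (-x) ^ n * Real.exp (c * -x) ∂μ : ℝ) : ℂ) := by
    intro n
    have hev : f =ᶠ[𝓝 (c : ℂ)] complexMGF (fun x => -x) μ :=
      hEq.eventuallyEq_of_mem (Metric.ball_mem_nhds _ hc0)
    rw [hev.iteratedDeriv_eq, iteratedDeriv_complexMGF (hI (by simpa using hc0)),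
      ← integral_complex_ofReal]
    simp
  have hsum := (Complex.hasSum_taylorSeries_on_ball (hf'.mono (hsub (3 * c) le_rfl))
    (z := ((-c : ℝ) : ℂ)) (by
      rw [mem_ball_iff_norm, ← Complex.ofReal_sub, Complex.norm_real, Real.norm_eq_abs,
        abs_of_neg] <;> linarith)).summable
  -- At `-c` the signs of `(-2c)^n` and of `(-x)^n` cancel, so the convergent Taylor series has
  -- nonnegative terms. Tonelli then sums it to the integral of `e^{2cx} e^{-cx} = e^{cx}`.
  have hterm : ∀ n : ℕ, ((n.factorial : ℂ)⁻¹ • (((-c : ℝ) : ℂ) - c) ^ n • iteratedDeriv n f c)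
      = ((∫ x, (2 * c * x) ^ n / n.factorial * Real.exp (c * -x) ∂μ : ℝ) : ℂ) := by
    intro n
    rw [hder]
    have h : ∫ x, (2 * c * x) ^ n / n.factorial * Real.exp (c * -x) ∂μ
        = (n.factorial : ℝ)⁻¹ * ((-c - c) ^ n * ∫ x, (-x) ^ n * Real.exp (c * -x) ∂μ) := by
      rw [← integral_const_mul, ← integral_const_mul]
      congr 1 with x
      rw [show 2 * c * x = (-c - c) * -x by ring, mul_pow]
      ring
    rw [h]
    push_cast
    simp only [smul_eq_mul]
  simp_rw [hterm] at hsum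
  rw [Complex.summable_ofReal] at hsum
  refine ⟨c, hc0, ?_⟩
  have hfin := integrable_exp_of_summable (X := fun x => 2 * c * x)
    (w := fun x => Real.exp (c * -x)) (by fun_prop) (by fun_prop)
    (by filter_upwards [hμ] with x hx using by positivity)
    (ae_of_all _ fun x => (Real.exp_pos _).le) (fun n => ?_) hsum
  · refine hfin.congr (ae_of_all _ fun x => ?_)
    simp only [← Real.exp_add]
    ring_nf
  · have := (integrable_pow_mul_exp_of_mem_interior_integrableExpSet (hI hc0) n).const_mul
      ((-2 * c) ^ n / n.factorial)
    refine this.congr (ae_of_all _ fun x => ?_)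
    simp only
    rw [show 2 * c * x = (-2 * c) * -x by ring, mul_pow (-2 * c)]
    ring

/-! ### Square integrability of the scaled Wiener exponentials -/

section

variable {Ω : Type*} [MeasurableSpace Ω] {P : Measure Ω} {B : ℝ → Ω → ℝ} {A : Ω → ℝ}

/-- The increment of a path over an interval. -/
def increment (B : ℝ → Ω → ℝ) (p : Interval) (ω : Ω) : ℝ := B p.1.2 ω - B p.1.1 ω

theorem IsTwoSidedBrownianMotion.measurable_increment (hB : IsTwoSidedBrownianMotion B P)
    (p : Interval) : Measurable (increment B p) :=
  (hB.measurable _).sub (hB.measurable _)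

theorem IsTwoSidedBrownianMotion.isGaussianProcess_increment
    (hB : IsTwoSidedBrownianMotion B P) : IsGaussianProcess (increment B) P := by
  classical
  exact hB.gaussian.of_isGaussianProcess fun p => ⟨{p.1.1, p.1.2},
    { toFun x := x ⟨p.1.2, by simp⟩ - x ⟨p.1.1, by simp⟩
      map_add' x y := by simp; abel
      map_smul' c x := by simp; ring },
    by simp [increment]⟩

/-- The pathwise elementary integral of a formal step function. -/
def pathIntegral (B : ℝ → Ω → ℝ) (c : Interval →₀ ℝ) (ω : Ω) : ℝ :=
  ∑ p ∈ c.support, c p * increment B p ω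

theorem IsTwoSidedBrownianMotion.coeFn_elementaryIntegral (hB : IsTwoSidedBrownianMotion B P)
    (c : Interval →₀ ℝ) : elementaryIntegral P B c =ᵐ[P] pathIntegral B c := by
  rw [elementaryIntegral, Finsupp.linearCombination_apply, Finsupp.sum]
  have h : ∀ᵐ ω ∂P, ∀ p ∈ c.support,
      (c p • incrementLp P B p.1.1 p.1.2 : Lp ℝ 2 P) ω = c p * increment B p ω := by
    rw [Filter.eventually_all_finset]
    intro p _
    filter_upwards [Lp.coeFn_smul (c p) (incrementLp P B p.1.1 p.1.2),
      hB.coeFn_incrementLp p.1.1 p.1.2] with ω h1 h2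
    rw [h1, Pi.smul_apply, h2, smul_eq_mul, increment]
  filter_upwards [h, Lp.coeFn_fun_finsetSum c.support fun p => c p • incrementLp P B p.1.1 p.1.2]
    with ω h1 h2
  rw [h2, pathIntegral]
  exact Finset.sum_congr rfl h1

theorem IsTwoSidedBrownianMotion.measurable_pathIntegral (hB : IsTwoSidedBrownianMotion B P)
    (c : Interval →₀ ℝ) : Measurable (pathIntegral B c) := by
  have := hB.measurable_increment
  unfold pathIntegral
  fun_prop

theorem IsTwoSidedBrownianMotion.map_pathIntegral (hB : IsTwoSidedBrownianMotion B P)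
    (c : Interval →₀ ℝ) :
    P.map (pathIntegral B c) = gaussianReal 0 (‖stepFun c‖ ^ 2).toNNReal := by
  have := hB.gaussian.isProbabilityMeasure
  have hG : HasGaussianLaw (pathIntegral B c) P :=
    (hB.isGaussianProcess_increment.smul c).hasGaussianLaw_fun_sum
  have hmean : ∫ ω, pathIntegral B c ω ∂P = 0 := by
    unfold pathIntegral increment
    have hi : ∀ t, Integrable (B t) P := fun t => (hB.memLp t).integrable (by norm_num)
    rw [integral_finsetSum _ fun p _ => Integrable.const_mul
      (f := fun ω => B p.1.2 ω - B p.1.1 ω) ((hi _).sub (hi _)) _]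
    refine Finset.sum_eq_zero fun p _ => ?_
    rw [integral_const_mul, integral_sub (hi _) (hi _), hB.mean, hB.mean, sub_zero, mul_zero]
  have hvar : Var[pathIntegral B c; P] = ‖stepFun c‖ ^ 2 := by
    rw [variance_of_integral_eq_zero (hB.measurable_pathIntegral c).aemeasurable hmean,
      ← hB.norm_elementaryIntegral, ← real_inner_self_eq_norm_sq, L2.inner_def]
    refine integral_congr_ae ?_
    filter_upwards [hB.coeFn_elementaryIntegral c] with ω h
    simp [h, sq]
  rw [hG.map_eq_gaussianReal, hmean, hvar]

theorem indepFun_pathIntegral (hAB : IndepFun A (fun ω t => B t ω) P) (c : Interval →₀ ℝ) :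
    IndepFun A (pathIntegral B c) P := by
  have h : Measurable fun x : ℝ → ℝ => ∑ p ∈ c.support, c p * (x p.1.2 - x p.1.1) := by fun_prop
  exact hAB.comp measurable_id h

/-- The Gaussian moment generating function, averaged over an independent variance. -/
theorem lintegral_exp_sqrt_mul_gaussian [IsProbabilityMeasure P] {J : Ω → ℝ} (hA : Measurable A)
    (hA0 : ∀ᵐ ω ∂P, 0 < A ω) (hJ : Measurable J) (hAJ : IndepFun A J P) {v : NNReal}
    (hJv : P.map J = gaussianReal 0 v) (r : ℝ) :
    ∫⁻ ω, ENNReal.ofReal (Real.exp (r * (√(A ω) * J ω))) ∂P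
      = ∫⁻ ω, ENNReal.ofReal (Real.exp (r ^ 2 * v / 2 * A ω)) ∂P := by
  have hm : Measurable fun x : ℝ × ℝ => ENNReal.ofReal (Real.exp (r * (√x.1 * x.2))) := by
    fun_prop
  have h1 : ∫⁻ ω, ENNReal.ofReal (Real.exp (r * (√(A ω) * J ω))) ∂P
      = ∫⁻ x, ENNReal.ofReal (Real.exp (r * (√x.1 * x.2))) ∂(P.map fun ω => (A ω, J ω)) := by
    rw [lintegral_map hm (hA.prodMk hJ)]
  -- By independence `A` can be frozen; the inner integral is the Gaussian moment generating
  -- function at `r√A`.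
  rw [h1, hAJ.map_prod_eq_prod_map_map hA.aemeasurable hJ.aemeasurable, lintegral_prod _
    hm.aemeasurable, hJv, lintegral_map (by fun_prop) hA]
  refine lintegral_congr_ae ?_
  filter_upwards [hA0] with ω hω
  have h2 := ofReal_integral_eq_lintegral_ofReal
    (integrable_exp_mul_gaussianReal (μ := 0) (v := v) (r * √(A ω)))
    (ae_of_all _ fun x => (Real.exp_pos _).le)
  have h3 := congrFun (mgf_fun_id_gaussianReal (μ := 0) (v := v)) (r * √(A ω))
  rw [mgf] at h3
  rw [h3] at h2
  simp only [← mul_assoc]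
  rw [← h2, mul_pow, Real.sq_sqrt hω.le]
  ring_nf

theorem exists_stepFun_seq (f : Lp ℝ 2 (volume : Measure ℝ)) :
    ∃ c : ℕ → Interval →₀ ℝ, Tendsto (fun n => stepFun (c n)) atTop (𝓝 f) := by
  obtain ⟨x, hx, hxf⟩ := mem_closure_iff_seq_limit.1 (denseRange_stepFun f)
  choose c hc using hx
  exact ⟨c, by simpa [hc] using hxf⟩

theorem exists_seq_tendsto_wienerIntegral_ae {u : ℕ → Lp ℝ 2 (volume : Measure ℝ)}
    {f : Lp ℝ 2 (volume : Measure ℝ)} (hu : Tendsto u atTop (𝓝 f)) :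
    ∃ ns : ℕ → ℕ, StrictMono ns ∧ ∀ᵐ ω ∂P,
      Tendsto (fun n => wienerIntegral P B (u (ns n)) ω) atTop (𝓝 (wienerIntegral P B f ω)) :=
  (tendstoInMeasure_of_tendsto_Lp
    (((wienerIntegral P B).continuous.tendsto f).comp hu)).exists_seq_tendsto_ae

/-- Fatou's lemma along step functions converging to `f`. The strict inequality on `K` leaves room
for the norms of the approximants, which need only be eventually close to `‖f‖`. -/
theorem IsTwoSidedBrownianMotion.lintegral_exp_sqrt_mul_wienerIntegral_le
    [IsProbabilityMeasure P] (hB : IsTwoSidedBrownianMotion B P) (hA : Measurable A)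
    (hA0 : ∀ᵐ ω ∂P, 0 < A ω) (hAB : IndepFun A (fun ω t => B t ω) P)
    (f : Lp ℝ 2 (volume : Measure ℝ)) (r : ℝ) {K : ℝ} (hK : r ^ 2 * ‖f‖ ^ 2 / 2 < K) :
    ∫⁻ ω, ENNReal.ofReal (Real.exp (r * (√(A ω) * wienerIntegral P B f ω))) ∂P
      ≤ ∫⁻ ω, ENNReal.ofReal (Real.exp (K * A ω)) ∂P := by
  obtain ⟨c, hc⟩ := exists_stepFun_seq f
  obtain ⟨ns, hns, hlim⟩ := exists_seq_tendsto_wienerIntegral_ae (P := P) (B := B) hc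
  simp only [hB.wienerIntegral_stepFun] at hlim
  have hbound : ∀ᶠ n in atTop, r ^ 2 * ‖stepFun (c (ns n))‖ ^ 2 / 2 < K := by
    have h1 : Tendsto (fun n => r ^ 2 * ‖stepFun (c (ns n))‖ ^ 2 / 2) atTop
        (𝓝 (r ^ 2 * ‖f‖ ^ 2 / 2)) :=
      (((hc.comp hns.tendsto_atTop).norm.pow 2).const_mul _).div_const _
    exact h1.eventually_lt_const hK
  have hcoe : ∀ᵐ ω ∂P, ∀ n, elementaryIntegral P B (c (ns n)) ω = pathIntegral B (c (ns n)) ω :=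
    ae_all_iff.2 fun n => hB.coeFn_elementaryIntegral _
  have hmeas := fun n => hB.measurable_pathIntegral (c (ns n))
  calc ∫⁻ ω, ENNReal.ofReal (Real.exp (r * (√(A ω) * wienerIntegral P B f ω))) ∂P
      = ∫⁻ ω, liminf (fun n => ENNReal.ofReal
          (Real.exp (r * (√(A ω) * pathIntegral B (c (ns n)) ω)))) atTop ∂P := by
        refine lintegral_congr_ae ?_
        filter_upwards [hlim, hcoe] with ω h1 h2
        simp only [h2] at h1
        refine (Tendsto.liminf_eq ?_).symm
        exact ENNReal.tendsto_ofReal ((Real.continuous_exp.tendsto _).comp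
          ((h1.const_mul _).const_mul _))
    _ ≤ liminf (fun n => ∫⁻ ω, ENNReal.ofReal
          (Real.exp (r * (√(A ω) * pathIntegral B (c (ns n)) ω))) ∂P) atTop :=
        lintegral_liminf_le fun n => by fun_prop
    _ ≤ liminf (fun _ : ℕ => ∫⁻ ω, ENNReal.ofReal (Real.exp (K * A ω)) ∂P) atTop := by
        refine liminf_le_liminf ?_
        filter_upwards [hbound] with n hn
        rw [lintegral_exp_sqrt_mul_gaussian hA hA0 (hmeas n) (indepFun_pathIntegral hAB _)
          (hB.map_pathIntegral _)]
        refine lintegral_mono_ae ?_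
        filter_upwards [hA0] with ω hω
        refine ENNReal.ofReal_le_ofReal (Real.exp_le_exp.2 ?_)
        rw [Real.coe_toNNReal _ (by positivity)]
        exact mul_le_mul_of_nonneg_right hn.le hω.le
    _ = _ := liminf_const _

/-- The scaled Wiener exponentials of small integrands are square integrable. -/
theorem IsTwoSidedBrownianMotion.memLp_exp_sqrt_mul_wienerIntegral
    [IsProbabilityMeasure P] (hB : IsTwoSidedBrownianMotion B P) (hA : Measurable A)
    (hA0 : ∀ᵐ ω ∂P, 0 < A ω) (hAB : IndepFun A (fun ω t => B t ω) P) {s : ℝ}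
    (hs : Integrable (fun ω => Real.exp (s * A ω)) P)
    {f : Lp ℝ 2 (volume : Measure ℝ)} (hf : 2 * ‖f‖ ^ 2 < s) :
    MemLp (fun ω => Real.exp (√(A ω) * wienerIntegral P B f ω)) 2 P := by
  have hm : AEMeasurable (wienerIntegral P B f) P := (Lp.aestronglyMeasurable _).aemeasurable
  rw [memLp_two_iff_integrable_sq (by fun_prop)]
  have hsq : (fun ω => Real.exp (√(A ω) * wienerIntegral P B f ω) ^ 2)
      = fun ω => Real.exp (2 * (√(A ω) * wienerIntegral P B f ω)) := by
    ext ω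
    rw [← Real.exp_nat_mul]
    norm_num
  rw [hsq]
  refine ⟨by fun_prop, ?_⟩
  rw [hasFiniteIntegral_iff_ofReal (ae_of_all _ fun ω => (Real.exp_pos _).le)]
  -- Squaring the exponential means `r = 2`, and `2² ‖f‖² / 2` is the quantity `2‖f‖²` of the
  -- hypothesis.
  refine (hB.lintegral_exp_sqrt_mul_wienerIntegral_le hA hA0 hAB f 2 (K := s)
    (by linarith)).trans_lt ?_
  rw [← hasFiniteIntegral_iff_ofReal (ae_of_all _ fun ω => (Real.exp_pos _).le)]
  exact hs.hasFiniteIntegral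

/-! ### Signed weights and analytic continuation -/

/-- The measure with density the positive part of a real function. -/
noncomputable def posDensity (P : Measure Ω) (Ψ : Ω → ℝ) : Measure Ω :=
  P.withDensity fun ω => (Ψ ω).toNNReal

theorem isFiniteMeasure_posDensity {Ψ : Ω → ℝ} (hΨ : Integrable Ψ P) :
    IsFiniteMeasure (posDensity P Ψ) :=
  isFiniteMeasure_withDensity_ofReal hΨ.hasFiniteIntegral

theorem integrable_posDensity {E : Type*} [NormedAddCommGroup E] [NormedSpace ℝ E]
    {Ψ : Ω → ℝ} {g : Ω → E} (hΨ : AEMeasurable Ψ P) (hg : AEStronglyMeasurable g P)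
    (hΨg : Integrable (fun ω => Ψ ω • g ω) P) : Integrable g (posDensity P Ψ) := by
  rw [posDensity, integrable_withDensity_iff_integrable_smul₀ hΨ.real_toNNReal]
  refine hΨg.mono ?_ (ae_of_all _ fun ω => ?_)
  · exact hΨ.real_toNNReal.coe_nnreal_real.aestronglyMeasurable.smul hg
  · rw [NNReal.smul_def, norm_smul, norm_smul]
    refine mul_le_mul_of_nonneg_right ?_ (norm_nonneg _)
    rw [Real.norm_of_nonneg (NNReal.coe_nonneg _), Real.coe_toNNReal', Real.norm_eq_abs]
    exact max_le (le_abs_self _) (abs_nonneg _)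

theorem integrable_posDensity_neg {E : Type*} [NormedAddCommGroup E] [NormedSpace ℝ E]
    {Ψ : Ω → ℝ} {g : Ω → E} (hΨ : AEMeasurable Ψ P) (hg : AEStronglyMeasurable g P)
    (hΨg : Integrable (fun ω => Ψ ω • g ω) P) : Integrable g (posDensity P (-Ψ)) :=
  integrable_posDensity hΨ.neg hg (by simpa using hΨg.neg)

/-- This is `Ψ = Ψ⁺ - Ψ⁻`. It lets results on moment generating functions and laws, stated for
positive measures, be applied to a signed weight. -/
theorem integral_posDensity_sub {E : Type*} [NormedAddCommGroup E] [NormedSpace ℝ E]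
    {Ψ : Ω → ℝ} {g : Ω → E} (hΨ : AEMeasurable Ψ P) (hg : AEStronglyMeasurable g P)
    (hΨg : Integrable (fun ω => Ψ ω • g ω) P) :
    ∫ ω, g ω ∂posDensity P Ψ - ∫ ω, g ω ∂posDensity P (-Ψ) = ∫ ω, Ψ ω • g ω ∂P := by
  have h1 := integrable_posDensity hΨ hg hΨg
  have h2 := integrable_posDensity_neg hΨ hg hΨg
  have hΨ' : AEMeasurable (-Ψ) P := hΨ.neg
  rw [posDensity, integrable_withDensity_iff_integrable_smul₀ hΨ.real_toNNReal] at h1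
  rw [posDensity, integrable_withDensity_iff_integrable_smul₀ hΨ'.real_toNNReal] at h2
  rw [posDensity, posDensity, integral_withDensity_eq_integral_smul₀ hΨ.real_toNNReal,
    integral_withDensity_eq_integral_smul₀ hΨ'.real_toNNReal, ← integral_sub h1 h2]
  congr 1 with ω
  rw [NNReal.smul_def, NNReal.smul_def, ← sub_smul, Real.coe_toNNReal', Real.coe_toNNReal',
    Pi.neg_apply, max_zero_sub_max_neg_zero_eq_self]

theorem integrable_smul_cexp_mul_I {Ψ X : Ω → ℝ} (hΨ : Integrable Ψ P) (hX : AEMeasurable X P) :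
    Integrable (fun ω => Ψ ω • Complex.exp (X ω * Complex.I)) P := by
  have hX' : AEMeasurable (fun ω => (X ω : ℂ)) P := Complex.measurable_ofReal.comp_aemeasurable hX
  refine hΨ.norm.mono (by fun_prop) (ae_of_all _ fun ω => ?_)
  simp [Complex.norm_exp_ofReal_mul_I]

/-- If the moment generating function of `X`, weighted by a signed density, vanishes near `0`, then
so does the weighted characteristic function, everywhere. -/
theorem integral_smul_cexp_eq_zero {Ψ X : Ω → ℝ} (hΨ : Integrable Ψ P) (hX : AEMeasurable X P)
    {δ : ℝ} (hδ : 0 < δ)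
    (hint : ∀ t, |t| < δ → Integrable (fun ω => Ψ ω • Real.exp (t * X ω)) P)
    (h0 : ∀ t, |t| < δ → ∫ ω, Ψ ω • Real.exp (t * X ω) ∂P = 0) :
    ∫ ω, Ψ ω • Complex.exp (X ω * Complex.I) ∂P = 0 := by
  have hm := hΨ.aestronglyMeasurable.aemeasurable
  have hpos : Ioo (-δ) δ ⊆ interior (integrableExpSet X (posDensity P Ψ)) :=
    interior_maximal (fun t ht =>
      integrable_posDensity hm (by fun_prop) (hint t (abs_lt.2 ht))) isOpen_Ioo
  have hneg : Ioo (-δ) δ ⊆ interior (integrableExpSet X (posDensity P (-Ψ))) :=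
    interior_maximal (fun t ht =>
      integrable_posDensity_neg hm (by fun_prop) (hint t (abs_lt.2 ht))) isOpen_Ioo
  have hEq : EqOn (complexMGF X (posDensity P Ψ)) (complexMGF X (posDensity P (-Ψ)))
      (Complex.re ⁻¹' Ioo (-δ) δ) := by
    refine AnalyticOnNhd.eqOn_of_preconnected_of_frequently_eq (z₀ := 0)
      (analyticOnNhd_complexMGF.mono fun z hz => hpos hz)
      (analyticOnNhd_complexMGF.mono fun z hz => hneg hz)
      ((convex_Ioo (-δ) δ).linear_preimage Complex.reLm).isPreconnected
      (by simpa using hδ) ?_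
    have hreal : ∀ᶠ t : ℝ in 𝓝[≠] 0,
        complexMGF X (posDensity P Ψ) t = complexMGF X (posDensity P (-Ψ)) t := by
      refine eventually_nhdsWithin_of_eventually_nhds ?_
      filter_upwards [Ioo_mem_nhds (neg_lt_zero.2 hδ) hδ] with t ht
      have ht' := abs_lt.2 ht
      rw [complexMGF_ofReal, complexMGF_ofReal, Complex.ofReal_inj, ← sub_eq_zero, mgf, mgf,
        integral_posDensity_sub hm (by fun_prop) (hint t ht'), h0 t ht']
    have hmap : Tendsto (fun t : ℝ => (t : ℂ)) (𝓝[≠] 0) (𝓝[≠] 0) := by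
      refine tendsto_nhdsWithin_iff.2 ⟨?_, ?_⟩
      · simpa using (Complex.continuous_ofReal.tendsto 0).mono_left nhdsWithin_le_nhds
      · filter_upwards [self_mem_nhdsWithin] with t ht using by simpa using ht
    exact hmap.frequently hreal.frequently
  have hX' : AEMeasurable (fun ω => (X ω : ℂ)) P := Complex.measurable_ofReal.comp_aemeasurable hX
  -- The strip `|Re z| < δ` contains the whole imaginary axis, however small `δ` is.
  have h1 := hEq (x := Complex.I) (by simpa using hδ)
  rw [← sub_eq_zero, complexMGF, complexMGF] at h1
  simp only [mul_comm Complex.I] at h1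
  rwa [integral_posDensity_sub hm (by fun_prop) (integrable_smul_cexp_mul_I hΨ hX)] at h1

/-! ### The weighted characteristic functional on `L²(ℝ)` -/

theorem scaledExp_smul_ae (η : 𝓢(ℝ, ℝ)) (t : ℝ) :
    scaledExp P B A (t • η) =ᵐ[P]
      fun ω => Real.exp (t * (√(A ω) * wienerIntegral P B (η.toLp 2 volume) ω)) := by
  have h : (t • η).toLp 2 (volume : Measure ℝ) = t • η.toLp 2 volume :=
    (SchwartzMap.toLpCLM ℝ ℝ 2 volume).map_smul t η
  filter_upwards [Lp.coeFn_smul t (wienerIntegral P B (η.toLp 2 volume))] with ω hω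
  rw [scaledExp, h, map_smul, hω, Pi.smul_apply, smul_eq_mul]
  ring_nf

/-- The weighted characteristic functional of `√A I(f)` is closed in `f`. -/
theorem isClosed_setOf_integral_smul_cexp_eq_zero {Ψ : Ω → ℝ} (hΨ : Integrable Ψ P)
    (hA : Measurable A) :
    IsClosed {f : Lp ℝ 2 (volume : Measure ℝ) |
      ∫ ω, Ψ ω • Complex.exp ((√(A ω) * wienerIntegral P B f ω : ℝ) * Complex.I) ∂P = 0} := by
  refine IsSeqClosed.isClosed fun u f hu huf => ?_
  obtain ⟨ns, hns, hlim⟩ := exists_seq_tendsto_wienerIntegral_ae (P := P) (B := B) huf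
  have hm : ∀ f, AEMeasurable (fun ω => √(A ω) * wienerIntegral P B f ω) P := fun f =>
    (by fun_prop : Measurable fun ω => √(A ω)).aemeasurable.mul
      (Lp.aestronglyMeasurable (wienerIntegral P B f)).aemeasurable
  -- The exponentials have modulus `1`, so `|Ψ|` dominates.
  have h1 := tendsto_integral_of_dominated_convergence (fun ω => ‖Ψ ω‖)
    (F := fun n ω => Ψ ω • Complex.exp
      ((√(A ω) * wienerIntegral P B (u (ns n)) ω : ℝ) * Complex.I))
    (f := fun ω => Ψ ω • Complex.exp ((√(A ω) * wienerIntegral P B f ω : ℝ) * Complex.I))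
    (fun n => (integrable_smul_cexp_mul_I hΨ (hm _)).aestronglyMeasurable) hΨ.norm
    (fun n => ae_of_all _ fun ω => by
      rw [norm_smul, Complex.norm_exp_ofReal_mul_I, mul_one])
    (by
      filter_upwards [hlim] with ω hω
      have hc : Continuous fun x : ℝ => Ψ ω • Complex.exp ((√(A ω) * x : ℝ) * Complex.I) := by
        fun_prop
      exact (hc.tendsto _).comp hω)
  simp only [mem_ofPred_eq] at hu ⊢
  simp only [hu] at h1
  exact (tendsto_nhds_unique h1 tendsto_const_nhds)

/-- If the weighted exponentials `E[Ψ e^{√A I(η)}]` vanish for all small Schwartz functions, then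
the weighted characteristic functional vanishes on all of `L²(ℝ)`. -/
theorem IsTwoSidedBrownianMotion.integral_smul_cexp_wienerIntegral_eq_zero
    [IsProbabilityMeasure P] (hB : IsTwoSidedBrownianMotion B P) (hA : Measurable A)
    (hA0 : ∀ᵐ ω ∂P, 0 < A ω) (hAB : IndepFun A (fun ω t => B t ω) P) {s : ℝ} (hs0 : 0 < s)
    (hs : Integrable (fun ω => Real.exp (s * A ω)) P) {Ψ : Ω → ℝ} (hΨ : MemLp Ψ 2 P)
    (h0 : ∀ η : 𝓢(ℝ, ℝ), 2 * ‖η.toLp 2 (volume : Measure ℝ)‖ ^ 2 < s →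
      ∫ ω, Ψ ω * scaledExp P B A η ω ∂P = 0) (f : Lp ℝ 2 (volume : Measure ℝ)) :
    ∫ ω, Ψ ω • Complex.exp ((√(A ω) * wienerIntegral P B f ω : ℝ) * Complex.I) ∂P = 0 := by
  have hΨ1 : Integrable Ψ P := hΨ.integrable (by norm_num)
  refine (SchwartzMap.denseRange_toLpCLM (E := ℝ) (F := ℝ) (p := 2) (μ := volume)
    (by norm_num)).induction_on (p := fun f => ∫ ω, Ψ ω • Complex.exp
      ((√(A ω) * wienerIntegral P B f ω : ℝ) * Complex.I) ∂P = 0) f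
    (isClosed_setOf_integral_smul_cexp_eq_zero hΨ1 hA) fun η => ?_
  rw [SchwartzMap.toLpCLM_apply]
  -- The given `η` may be large; `tη` is small enough for all `t` near `0`.
  obtain ⟨δ, hδ, hδs⟩ : ∃ δ > 0, ∀ t : ℝ, |t| < δ →
      2 * ‖(t • η).toLp 2 (volume : Measure ℝ)‖ ^ 2 < s := by
    have hc : ContinuousAt (fun t : ℝ => 2 * ‖(t • η).toLp 2 (volume : Measure ℝ)‖ ^ 2) 0 := by
      have h : ∀ t : ℝ, (t • η).toLp 2 (volume : Measure ℝ) = t • η.toLp 2 volume := fun t =>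
        (SchwartzMap.toLpCLM ℝ ℝ 2 volume).map_smul t η
      simp only [h]
      fun_prop
    have h2 := hc.tendsto.eventually_lt_const (u := s) (by
      have : (0 : 𝓢(ℝ, ℝ)).toLp 2 (volume : Measure ℝ) = 0 :=
        (SchwartzMap.toLpCLM ℝ ℝ 2 volume).map_zero
      simpa [this] using hs0)
    obtain ⟨δ, hδ, h3⟩ := Metric.eventually_nhds_iff.1 h2
    exact ⟨δ, hδ, fun t ht => h3 (by simpa using ht)⟩
  refine integral_smul_cexp_eq_zero hΨ1 ?_ hδ (fun t ht => ?_) fun t ht => ?_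
  · exact (by fun_prop : Measurable fun ω => √(A ω)).aemeasurable.mul
      (Lp.aestronglyMeasurable (wienerIntegral P B (η.toLp 2 volume))).aemeasurable
  · have h := hΨ.integrable_mul
      (hB.memLp_exp_sqrt_mul_wienerIntegral hA hA0 hAB hs (hδs t ht))
    refine h.congr ?_
    filter_upwards [scaledExp_smul_ae (P := P) (B := B) (A := A) η t] with ω hω
    rw [smul_eq_mul, ← hω]
    rfl
  · rw [← h0 _ (hδs t ht)]
    refine integral_congr_ae ?_
    filter_upwards [scaledExp_smul_ae (P := P) (B := B) (A := A) η t] with ω hω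
    rw [hω, smul_eq_mul]

/-! ### Laws of the scaled increments -/

/-- The increments of the scaled process `√A B`. -/
noncomputable def scaledIncrement (B : ℝ → Ω → ℝ) (A : Ω → ℝ) (ω : Ω) (p : Interval) : ℝ :=
  √(A ω) * increment B p ω

theorem IsTwoSidedBrownianMotion.measurable_scaledIncrement (hB : IsTwoSidedBrownianMotion B P)
    (hA : Measurable A) : Measurable (scaledIncrement B A) := by
  have := hB.measurable_increment
  unfold scaledIncrement
  fun_prop

theorem pathIntegral_eq_linearCombination {Ω : Type*} {B : ℝ → Ω → ℝ} (c : Interval →₀ ℝ) (ω : Ω) :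
    pathIntegral B c ω = Finsupp.linearCombination ℝ (fun p => increment B p ω) c := by
  simp [pathIntegral, Finsupp.linearCombination_apply, Finsupp.sum]

/-- A linear functional of finitely many scaled increments is a scaled elementary integral. -/
theorem exists_dual_scaledIncrement_eq {Ω : Type*} {B : ℝ → Ω → ℝ} {A : Ω → ℝ}
    (I : Finset Interval) (L : StrongDual ℝ (I → ℝ)) :
    ∃ c : Interval →₀ ℝ, ∀ ω,
      L (I.restrict (scaledIncrement B A ω)) = √(A ω) * pathIntegral B c ω := by
  classical
  refine ⟨∑ i : I, Finsupp.single i.1 (L (Pi.single i 1)), fun ω => ?_⟩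
  rw [pathIntegral_eq_linearCombination, map_sum, Finset.mul_sum,
    ← L.sum_comp_single]
  refine Finset.sum_congr rfl fun i _ => ?_
  have h : (Pi.single i (I.restrict (scaledIncrement B A ω) i) : I → ℝ)
      = scaledIncrement B A ω i • Pi.single i 1 := by
    rw [← Pi.single_smul, smul_eq_mul, mul_one, Finset.restrict_def]
  simp only [ContinuousLinearMap.comp_apply, ContinuousLinearMap.single_apply, h, map_smul,
    smul_eq_mul, Finsupp.linearCombination_single, scaledIncrement]
  ring

/-- If the weighted characteristic functional of `√A I(f)` vanishes on step functions, then the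
positive and negative parts of the weight induce the same law of the scaled increments. -/
theorem IsTwoSidedBrownianMotion.map_scaledIncrement_posDensity_eq
    (hB : IsTwoSidedBrownianMotion B P) (hA : Measurable A) {Ψ : Ω → ℝ} (hΨ : Integrable Ψ P)
    (h0 : ∀ f : Lp ℝ 2 (volume : Measure ℝ),
      ∫ ω, Ψ ω • Complex.exp ((√(A ω) * wienerIntegral P B f ω : ℝ) * Complex.I) ∂P = 0) :
    (posDensity P Ψ).map (scaledIncrement B A) = (posDensity P (-Ψ)).map (scaledIncrement B A) := by
  have := isFiniteMeasure_posDensity hΨ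
  have := isFiniteMeasure_posDensity hΨ.neg
  have hY := hB.measurable_scaledIncrement hA
  -- A finite measure on the product space is determined by its finite-dimensional marginals, and
  -- these by their characteristic functions.
  refine IsProjectiveLimit.unique (P := fun I : Finset Interval =>
    ((posDensity P (-Ψ)).map (scaledIncrement B A)).map I.restrict) (fun I => ?_) fun I => rfl
  refine Measure.ext_of_charFunDual (funext fun L => ?_)
  beta_reduce
  obtain ⟨c, hc⟩ := exists_dual_scaledIncrement_eq (B := B) (A := A) I L
  have hr : Measurable (I.restrict : (Interval → ℝ) → I → ℝ) := Finset.measurable_restrict I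
  have hL : Measurable fun x : I → ℝ => Complex.exp (L x * Complex.I) := by fun_prop
  have hJ := hB.measurable_pathIntegral c
  have hX : Measurable fun ω => √(A ω) * pathIntegral B c ω := by fun_prop
  rw [charFunDual_apply, charFunDual_apply, Measure.map_map hr hY, Measure.map_map hr hY,
    integral_map (hr.comp hY).aemeasurable hL.aestronglyMeasurable,
    integral_map (hr.comp hY).aemeasurable hL.aestronglyMeasurable]
  simp only [Function.comp_apply, hc]
  rw [← sub_eq_zero, integral_posDensity_sub hΨ.aestronglyMeasurable.aemeasurable (by fun_prop)
    (integrable_smul_cexp_mul_I hΨ hX.aemeasurable), ← h0 (stepFun c)]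
  refine integral_congr_ae ?_
  rw [hB.wienerIntegral_stepFun]
  filter_upwards [hB.coeFn_elementaryIntegral c] with ω hω
  rw [hω]

/-- On an event `Y ⁻¹' S` the integral of `Ψ` is the difference of the masses given to `S` by the
two image measures. -/
theorem setIntegral_eq_zero_of_map_posDensity_eq {β : Type*} [MeasurableSpace β] {Y : Ω → β}
    (hY : Measurable Y) {Ψ : Ω → ℝ} (hΨ : Integrable Ψ P)
    (h : (posDensity P Ψ).map Y = (posDensity P (-Ψ)).map Y) {D : Set Ω}
    (hD : MeasurableSet[MeasurableSpace.comap Y inferInstance] D) : ∫ ω in D, Ψ ω ∂P = 0 := by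
  obtain ⟨S, hS, rfl⟩ := hD
  have hD := hY hS
  have h1 : (posDensity P Ψ).real (Y ⁻¹' S) = (posDensity P (-Ψ)).real (Y ⁻¹' S) := by
    rw [Measure.real, Measure.real, ← Measure.map_apply hY hS, h, Measure.map_apply hY hS]
  have heq : (fun ω => Ψ ω • (Y ⁻¹' S).indicator (1 : Ω → ℝ) ω) = (Y ⁻¹' S).indicator Ψ := by
    ext ω
    by_cases hω : ω ∈ Y ⁻¹' S <;> simp [hω]
  have h2 := integral_posDensity_sub (g := (Y ⁻¹' S).indicator (1 : Ω → ℝ))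
    hΨ.aestronglyMeasurable.aemeasurable
    (measurable_one.indicator hD).aestronglyMeasurable (by
      rw [heq]
      exact hΨ.indicator hD)
  rwa [heq, integral_indicator_one hD, integral_indicator_one hD, h1, sub_self,
    integral_indicator hD, eq_comm] at h2

/-! ### Recovering `A` and `B` from the scaled increments -/

theorem IsTwoSidedBrownianMotion.covariance_increment (hB : IsTwoSidedBrownianMotion B P)
    (p q : Interval) :
    cov[increment B p, increment B q; P] = volume.real (Ioc p.1.1 p.1.2 ∩ Ioc q.1.1 q.1.2) := by
  have := hB.gaussian.isProbabilityMeasure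
  unfold increment
  rw [covariance_fun_sub_fun_sub (hB.memLp _) (hB.memLp _) (hB.memLp _) (hB.memLp _)]
  simp only [hB.covariance]
  rw [volume_real_Ioc_inter p.2 q.2]
  ring

/-- The interval `(k, k + 1]`. -/
def natInterval (k : ℕ) : Interval := ⟨((k : ℝ), (k : ℝ) + 1), by simp⟩

theorem IsTwoSidedBrownianMotion.covariance_increment_natInterval
    (hB : IsTwoSidedBrownianMotion B P) {j k : ℕ} (hjk : j ≠ k) :
    cov[increment B (natInterval j), increment B (natInterval k); P] = 0 := by
  rw [hB.covariance_increment, Disjoint.inter_eq, measureReal_empty]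
  rw [natInterval, natInterval, Ioc_disjoint_Ioc]
  rcases lt_or_gt_of_ne hjk with h | h
  · have h' : (j : ℝ) + 1 ≤ k := by exact_mod_cast h
    exact (min_le_left _ _).trans (le_max_of_le_right h')
  · have h' : (k : ℝ) + 1 ≤ j := by exact_mod_cast h
    exact (min_le_right _ _).trans (le_max_of_le_left h')

theorem IsTwoSidedBrownianMotion.integral_increment (hB : IsTwoSidedBrownianMotion B P)
    (p : Interval) : ∫ ω, increment B p ω ∂P = 0 := by
  have := hB.gaussian.isProbabilityMeasure
  unfold increment
  rw [integral_sub ((hB.memLp _).integrable (by norm_num))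
    ((hB.memLp _).integrable (by norm_num)), hB.mean, hB.mean, sub_zero]

theorem IsTwoSidedBrownianMotion.variance_increment_natInterval
    (hB : IsTwoSidedBrownianMotion B P) (k : ℕ) : Var[increment B (natInterval k); P] = 1 := by
  rw [← covariance_self (hB.measurable_increment _).aemeasurable, hB.covariance_increment]
  simp [natInterval]

/-- The averaged squared increments of a Brownian motion converge to `1`. -/
theorem IsTwoSidedBrownianMotion.tendsto_average_sq_increment
    (hB : IsTwoSidedBrownianMotion B P) :
    ∀ᵐ ω ∂P, Tendsto (fun n : ℕ =>
      (∑ k ∈ Finset.range n, increment B (natInterval k) ω ^ 2) / n) atTop (𝓝 1) := by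
  have := hB.gaussian.isProbabilityMeasure
  have hG := hB.isGaussianProcess_increment
  have hm := hB.measurable_increment
  have h := strong_law_ae_real (μ := P) (fun k ω => increment B (natInterval k) ω ^ 2)
    ((hG.hasGaussianLaw_eval _).memLp_two.integrable_sq) (fun j k hjk => ?_) fun k => ?_
  · have h1 : ∫ ω, increment B (natInterval 0) ω ^ 2 ∂P = 1 := by
      rw [← hB.variance_increment_natInterval 0,
        variance_of_integral_eq_zero (hm _).aemeasurable (hB.integral_increment _)]
    rwa [h1] at h
  -- Jointly Gaussian and uncorrelated increments are independent, hence so are their squares.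
  · exact (hG.hasGaussianLaw_prodMk.indepFun_of_covariance_eq_zero
      (hB.covariance_increment_natInterval hjk)).comp (measurable_id.pow_const 2)
      (measurable_id.pow_const 2)
  · refine IdentDistrib.comp (u := fun x : ℝ => x ^ 2)
      ⟨(hm _).aemeasurable, (hm _).aemeasurable, ?_⟩ (by fun_prop)
    rw [(hG.hasGaussianLaw_eval _).map_eq_gaussianReal,
      (hG.hasGaussianLaw_eval _).map_eq_gaussianReal, hB.integral_increment, hB.integral_increment, hB.variance_increment_natInterval,
      hB.variance_increment_natInterval]

theorem IsTwoSidedBrownianMotion.ae_eq_zero (hB : IsTwoSidedBrownianMotion B P) :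
    ∀ᵐ ω ∂P, B 0 ω = 0 := by
  have := hB.gaussian.isProbabilityMeasure
  have h : Var[B 0; P] = 0 := by
    rw [← covariance_self (hB.measurable 0).aemeasurable, hB.covariance]
    simp
  have h2 := ae_eq_integral_of_variance_eq_zero (hB.memLp 0) h
  rwa [hB.mean] at h2

/-- The variance recovered from the scaled increments. -/
noncomputable def empiricalVariance (B : ℝ → Ω → ℝ) (A : Ω → ℝ) (ω : Ω) : ℝ :=
  limsup (fun n : ℕ =>
    (∑ k ∈ Finset.range n, scaledIncrement B A ω (natInterval k) ^ 2) / n) atTop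

/-- Using `limsup` rather than a limit makes the quantity defined everywhere as a measurable
function of the scaled increments alone. -/
theorem measurable_empiricalVariance {Ω : Type*} {B : ℝ → Ω → ℝ} {A : Ω → ℝ} :
    Measurable[MeasurableSpace.comap (scaledIncrement B A) inferInstance]
      (empiricalVariance B A) := by
  have h : Measurable fun y : Interval → ℝ => limsup (fun n : ℕ =>
      (∑ k ∈ Finset.range n, y (natInterval k) ^ 2) / n) atTop :=
    Measurable.limsup fun n => by fun_prop
  exact h.comp (comap_measurable (scaledIncrement B A))

theorem IsTwoSidedBrownianMotion.empiricalVariance_ae_eq (hB : IsTwoSidedBrownianMotion B P)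
    (hA0 : ∀ᵐ ω ∂P, 0 < A ω) : empiricalVariance B A =ᵐ[P] A := by
  filter_upwards [hB.tendsto_average_sq_increment, hA0] with ω h hω
  have h1 := h.const_mul (A ω)
  rw [mul_one] at h1
  rw [empiricalVariance, ← h1.limsup_eq]
  simp only [scaledIncrement, mul_pow, Real.sq_sqrt hω.le, ← Finset.mul_sum, mul_div_assoc]

/-- Up to null sets, `σ(B, A)` is generated by the increments of `√A B`. -/
theorem IsTwoSidedBrownianMotion.sigmaBA_le_eventuallyMeasurableSpace
    (hB : IsTwoSidedBrownianMotion B P) (hA0 : ∀ᵐ ω ∂P, 0 < A ω) :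
    sigmaBA B A ≤ eventuallyMeasurableSpace
      (MeasurableSpace.comap (scaledIncrement B A) inferInstance) (ae P) := by
  have hV := measurable_empiricalVariance (B := B) (A := A)
  have hVA := hB.empiricalVariance_ae_eq hA0
  have hY : ∀ p, Measurable[MeasurableSpace.comap (scaledIncrement B A) inferInstance]
      fun ω => scaledIncrement B A ω p :=
    fun p => (measurable_pi_apply p).comp (comap_measurable (scaledIncrement B A))
  refine sup_le (iSup_le fun t => Measurable.comap_le ?_) (Measurable.comap_le ?_)
  -- Dividing by the square root of the recovered variance removes the factor `√A`; since `B 0 = 0`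
  -- almost surely, increments from or to `0` give `B t` up to sign.
  · have hq : ∀ p, Measurable[MeasurableSpace.comap (scaledIncrement B A) inferInstance]
        fun ω => scaledIncrement B A ω p / √(empiricalVariance B A ω) := fun p =>
      (hY p).div (Real.continuous_sqrt.measurable.comp hV)
    have hqB : ∀ p, ∀ᵐ ω ∂P,
        scaledIncrement B A ω p / √(empiricalVariance B A ω) = increment B p ω := fun p => by
      filter_upwards [hVA, hA0] with ω h1 h2
      rw [h1, scaledIncrement, mul_div_cancel_left₀ _ (Real.sqrt_pos.2 h2).ne']
    rcases le_total 0 t with ht | ht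
    · refine Measurable.eventuallyMeasurable_of_eventuallyEq (hq ⟨(0, t), ht⟩) ?_
      filter_upwards [hqB ⟨(0, t), ht⟩, hB.ae_eq_zero] with ω h1 h2
      rw [h1, increment, h2, sub_zero]
    · refine Measurable.eventuallyMeasurable_of_eventuallyEq (hq ⟨(t, 0), ht⟩).neg ?_
      filter_upwards [hqB ⟨(t, 0), ht⟩, hB.ae_eq_zero] with ω h1 h2
      rw [Pi.neg_apply, h1, increment, h2, zero_sub, neg_neg]
  · exact Measurable.eventuallyMeasurable_of_eventuallyEq hV hVA.symm

theorem IsTwoSidedBrownianMotion.sigmaBA_le (hB : IsTwoSidedBrownianMotion B P)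
    (hA : Measurable A) : sigmaBA B A ≤ ‹MeasurableSpace Ω› :=
  sup_le (iSup_le fun t => (hB.measurable t).comap_le) hA.comap_le

/-! ### Injectivity of the transform -/

/-- The weighted exponentials of `√A I(η)`, for small Schwartz functions `η`, determine an element
of `L²_A`. -/
theorem IsTwoSidedBrownianMotion.L2A_ext_of_integral_mul_scaledExp_eq [IsProbabilityMeasure P]
    (hB : IsTwoSidedBrownianMotion B P) (hA : Measurable A) (hA0 : ∀ᵐ ω ∂P, 0 < A ω)
    (hAB : IndepFun A (fun ω t => B t ω) P) {s : ℝ} (hs0 : 0 < s)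
    (hs : Integrable (fun ω => Real.exp (s * A ω)) P) {Θ Φ : L2A P B A}
    (h : ∀ η : 𝓢(ℝ, ℝ), 2 * ‖η.toLp 2 (volume : Measure ℝ)‖ ^ 2 < s →
      ∫ ω, (Θ : Lp ℝ 2 P) ω * scaledExp P B A η ω ∂P
        = ∫ ω, (Φ : Lp ℝ 2 P) ω * scaledExp P B A η ω ∂P) : Θ = Φ := by
  have hΘ := Lp.memLp (Θ : Lp ℝ 2 P)
  have hΦ := Lp.memLp (Φ : Lp ℝ 2 P)
  have hΘ1 := hΘ.integrable (by norm_num)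
  have hΦ1 := hΦ.integrable (by norm_num)
  set Ψ : Ω → ℝ := (Θ : Lp ℝ 2 P) - (Φ : Lp ℝ 2 P) with hΨdef
  have hΨ : MemLp Ψ 2 P := hΘ.sub hΦ
  have hchar := hB.integral_smul_cexp_wienerIntegral_eq_zero hA hA0 hAB hs0 hs hΨ fun η hη => by
    have hE := hB.memLp_exp_sqrt_mul_wienerIntegral hA hA0 hAB hs hη
    have h1 := integral_sub (hΘ.integrable_mul hE) (hΦ.integrable_mul hE)
    rw [← sub_eq_zero.2 (h η hη)]
    refine Eq.trans ?_ h1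
    simp only [hΨdef, Pi.sub_apply, sub_mul]
    rfl
  have hmap := hB.map_scaledIncrement_posDensity_eq hA (hΨ.integrable (by norm_num)) hchar
  refine Subtype.ext (Lp.ext ?_)
  have hm := hB.sigmaBA_le hA
  refine ae_eq_of_forall_setIntegral_eq_of_sigmaFinite' hm
    (fun _ _ _ => hΘ1.integrableOn) (fun _ _ _ => hΦ1.integrableOn) (fun C hC _ => ?_)
    (mem_lpMeas_iff_aestronglyMeasurable.1 Θ.2) (mem_lpMeas_iff_aestronglyMeasurable.1 Φ.2)
  -- `C` in `σ(B, A)` is replaced by an almost surely equal event `D` generated by the scaled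
  -- increments.
  obtain ⟨D, hD, hCD⟩ := hB.sigmaBA_le_eventuallyMeasurableSpace hA0 C hC
  rw [← sub_eq_zero, ← integral_sub hΘ1.integrableOn hΦ1.integrableOn, setIntegral_congr_set hCD]
  exact setIntegral_eq_zero_of_map_posDensity_eq (hB.measurable_scaledIncrement hA)
    (hΨ.integrable (by norm_num)) hmap hD

end

end ScaledWiener

theorem mainTheorem2 {Ω : Type*} [MeasurableSpace Ω] (P : Measure Ω) [IsProbabilityMeasure P]
    (B : ℝ → Ω → ℝ) (hB : ScaledWiener.IsTwoSidedBrownianMotion B P)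
    (A : Ω → ℝ) (hA : Measurable A) (hA_pos : ∀ᵐ ω ∂P, 0 < A ω)
    (hAB : IndepFun A (fun ω t => B t ω) P)
    (hR : 0 < ScaledWiener.laplaceRadius (P.map A))
    (Θ Φ : ScaledWiener.L2A P B A) :
    (∀ η : ScaledWiener.admissible P A,
      ScaledWiener.transformSA P B A Θ η = ScaledWiener.transformSA P B A Φ η) ↔ Θ = Φ := by
  refine ⟨fun h => ?_, fun h _ => by rw [h]⟩
  have := Measure.isProbabilityMeasure_map hA.aemeasurable (μ := P)
  obtain ⟨s, hs0, hs⟩ := ScaledWiener.exists_integrable_exp_of_laplaceRadius_pos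
    ((ae_map_iff hA.aemeasurable measurableSet_Ioi).2 hA_pos) hR
  rw [integrable_map_measure (by fun_prop) hA.aemeasurable] at hs
  obtain ⟨q, hq0, hqR⟩ := ENNReal.lt_iff_exists_nnreal_btwn.1 hR
  -- Below `s` the exponentials are square integrable; below `q < R_A` the test function is
  -- admissible.
  have hr0 : 0 < min s q := lt_min hs0 (by simpa using hq0)
  refine hB.L2A_ext_of_integral_mul_scaledExp_eq hA hA_pos hAB hr0
    (integrable_exp_mul_of_nonneg_of_le hs hr0.le (min_le_left _ _)) fun η hη => ?_
  have hadm : η ∈ ScaledWiener.admissible P A := by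
    refine lt_of_le_of_lt (ENNReal.ofReal_le_ofReal (hη.le.trans (min_le_right _ _))) ?_
    simpa using hqR
  have hE := (hB.memLp_exp_sqrt_mul_wienerIntegral hA hA_pos hAB hs
    (hη.trans_le (min_le_left _ _))).integrable (by norm_num)
  have hpos : 0 < ∫ ω, ScaledWiener.scaledExp P B A η ω ∂P := integral_exp_pos hE
  have h1 := h ⟨η, hadm⟩
  simp only [ScaledWiener.transformSA, ScaledWiener.wickExp, ← mul_assoc] at h1
  rw [integral_mul_const, integral_mul_const] at h1
  exact mul_right_cancel₀ (inv_ne_zero hpos.ne') h1
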